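/- Let $\mathbb T=\mathbb R/2\pi\mathbb Z$, write $z=(x,y)\in\mathbb R\times\mathbb T$ and $\zeta=(\xi,\eta)\in\mathbb R\times\mathbb Z$, with $|\zeta|=(\xi^2+\eta^2)^{1/2}$, and let $(d\zeta)$ be the product of Lebesgue measure in $\xi$ and counting measure in $\eta$. For $f\in L^2(\mathbb R\times\mathbb R\times\mathbb T)$ let $$\widehat f(\tau,\zeta)=\frac1{(2\pi)^{3/2}}\int_{\mathbb R\times\mathbb R\times\mathbb T}e^{-it\tau-iz\cdot\zeta}f(t,z)\,dt\,dz$$ be its space-time Fourier transform (in the sense of Plancherel), put $\langle r\rangle=(1+r^2)^{1/2}$, and $$\|f\|_{X^{0,b}}=\Big(\int\!\int_{\mathbb R}\langle\tau-|\zeta|^2\rangle^{2b}|\widehat f(\tau,\zeta)|^2\,d\tau\,(d\zeta)\Big)^{1/2}.$$ For $b\ge 0$, $X^{0,b}$ is the space of $f\in L^2(\mathbb R\times\mathbb R\times\mathbb T)$ for which this norm is finite. **Proposition 3.1.** Let $\varepsilon>0$, $K\ge1$ and $c>0$, and put $b=\tfrac12+\varepsilon$. There is a constant $C>0$, depending only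 on $\varepsilon$, $K$ and $c$, such that the following holds. Let $1<N_1\le N_2$ and $M>1$, and let $f_{N_1},f_{N_2}\in X^{0,b}$ have spatial frequencies $N_1,N_2$, that is, $K^{-1}N_j\le|\zeta|\le KN_j$ for almost every $(\tau,\zeta)$ with $\widehat f_{N_j}(\tau,\zeta)\neq0$. Then the integral $$F(t,z)=\int_{\mathbb R^2}\!\int e^{-it(\tau_1+\tau_2)-iz\cdot(\zeta_1+\zeta_2)}\,1_{|\xi_1-\xi_2|\ge cM}\,\widehat f_{N_1}(\tau_1,\zeta_1)\,\widehat f_{N_2}(\tau_2,\zeta_2)\,(d\zeta_1)(d\zeta_2)\,d\tau_1\,d\tau_2$$ converges absolutely for every $(t,z)$, $F\in L^2(\mathbb R\times\mathbb R\times\mathbb T)$, and $$\|F\|_{L^2(\mathbb R\times\mathbb R\times\mathbb T)}\le C\,\frac{N_1^{1/2}}{M^{1/2}}\,\|f_{N_1}\|_{X^{0,b}}\|f_{N_2}\|_{X^{0,b}}.$$ The same conclusions, with the same right-hand side, hold for $$F(t,z)=\int_{\mathbb R^2}\!\int e^{-it(\tau_1+\tau_2)-iz\cdot(\zeta_1+\zeta_2)}\,1_{|\xi_1+\xi_2|\ge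 cM}\,\widehat f_{N_1}(\tau_1,\zeta_1)\,\widehat{\overline{f_{N_2}}}(\tau_2,\zeta_2)\,(d\zeta_1)(d\zeta_2)\,d\tau_1\,d\tau_2.$$ -/

import Mathlib

open MeasureTheory Filter Topology

/-- The circle `𝕋 = ℝ / 2πℤ` has positive length. -/
instance fact_two_pi_pos_torus : Fact (0 < 2 * Real.pi) := ⟨Real.two_pi_pos⟩

/-- Space-time `ℝ × ℝ × 𝕋` with `𝕋 = ℝ / 2πℤ`; its points are `(t, z)` with `z = (x, y) ∈ ℝ × 𝕋`.
It carries the product measure `volume`, in which `𝕋` has total mass `2π`. -/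
abbrev SpaceTime : Type := ℝ × ℝ × AddCircle (2 * Real.pi)

/-- The dual group `ℝ × ℝ × ℤ`; its points are `(τ, ζ)` with `ζ = (ξ, η) ∈ ℝ × ℤ`. -/
abbrev Freq : Type := ℝ × ℝ × ℤ

/-- The measure `dτ (dζ)` on `ℝ × ℝ × ℤ`: Lebesgue measure in `τ` and `ξ`, counting measure in
`η`. -/
noncomputable def freqMeasure : Measure Freq :=
  (volume : Measure ℝ).prod ((volume : Measure ℝ).prod (Measure.count : Measure ℤ))

/-- The Euclidean length `|ζ| = (ξ² + η²)^{1/2}` of the spatial part of a frequency. -/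
noncomputable def spatialLength (p : Freq) : ℝ := Real.sqrt (p.2.1 ^ 2 + (p.2.2 : ℝ) ^ 2)

/-- The Japanese bracket `⟨r⟩ = (1 + r²)^{1/2}`. -/
noncomputable def japaneseBracket (r : ℝ) : ℝ := Real.sqrt (1 + r ^ 2)

/-- The character `e^{-i t τ - i z · ζ}`, where `z · ζ = x ξ + y η`.
Here `fourier (-η) y = e^{-i η y}` since the circle has length `2π`. -/
noncomputable def stChar (p : Freq) (q : SpaceTime) : ℂ :=
  Complex.exp (-(Complex.I * ((q.1 * p.1 + q.2.1 * p.2.1 : ℝ) : ℂ))) * fourier (-p.2.2) q.2.2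

/-- The truncated space-time Fourier integral
`(2π)^{-3/2} ∫_{|t| ≤ R, |x| ≤ R, y ∈ 𝕋} e^{-itτ - iz·ζ} f(t,z) dt dz`, which converges absolutely
for every `f ∈ L²`. -/
noncomputable def stFourierTrunc (f : SpaceTime → ℂ) (R : ℝ) (p : Freq) : ℂ :=
  (((2 * Real.pi) ^ (-(3 / 2 : ℝ)) : ℝ) : ℂ) *
    ∫ q in Set.Icc (-R) R ×ˢ Set.Icc (-R) R ×ˢ Set.univ, stChar p q * f q

/-- `g` is the space-time Fourier transform of `f` in the sense of Plancherel: `g` is the limit in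
`L²(ℝ × ℝ × ℤ)` of the truncated Fourier integrals of `f`. -/
def IsSTFourier (f : SpaceTime → ℂ) (g : Freq → ℂ) : Prop :=
  MemLp g 2 freqMeasure ∧
    Tendsto (fun R : ℝ => eLpNorm (stFourierTrunc f R - g) 2 freqMeasure) atTop (𝓝 0)

open Classical in
/-- The space-time Fourier transform of `f ∈ L²(ℝ × ℝ × 𝕋)`, a function on `ℝ × ℝ × ℤ` that is
determined up to null sets. (By Plancherel's theorem it exists for every `f ∈ L²`.) -/
noncomputable def stFourier (f : SpaceTime → ℂ) : Freq → ℂ :=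
  if h : ∃ g, IsSTFourier f g then h.choose else 0

/-- The norm
`‖f‖_{X^{s,b}} = (∫ ∫ ⟨ζ⟩^{2s} ⟨τ - |ζ|²⟩^{2b} |f̂(τ,ζ)|² dτ (dζ))^{1/2}`, with value in `[0,∞]`. -/
noncomputable def xNorm (s b : ℝ) (f : SpaceTime → ℂ) : ENNReal :=
  (∫⁻ p, ENNReal.ofReal (japaneseBracket (spatialLength p) ^ (2 * s) *
      japaneseBracket (p.1 - spatialLength p ^ 2) ^ (2 * b)) * ‖stFourier f p‖ₑ ^ 2
    ∂freqMeasure) ^ (1 / 2 : ℝ)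

/-- Membership in `X^{s,b}` for `s, b ≥ 0`, in which range `X^{s,b} ⊆ L²(ℝ × ℝ × 𝕋)`. -/
def MemX (s b : ℝ) (f : SpaceTime → ℂ) : Prop :=
  MemLp f 2 volume ∧ xNorm s b f < ⊤

/-- `f` has spatial frequency `N`: its Fourier transform is supported in `|ζ| ∼ N`, where the
comparability constant is `K`. -/
def HasSpatialFreq (K N : ℝ) (f : SpaceTime → ℂ) : Prop :=
  ∀ᵐ p ∂freqMeasure, stFourier f p ≠ 0 → K⁻¹ * N ≤ spatialLength p ∧ spatialLength p ≤ K * N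

/-- The integrand
`e^{-it(τ₁+τ₂) - iz·(ζ₁+ζ₂)} 1_S(ξ₁,ξ₂) g₁(τ₁,ζ₁) g₂(τ₂,ζ₂)`, as a function of
`p = ((τ₁,ζ₁), (τ₂,ζ₂))`. -/
noncomputable def bilinearIntegrand (S : Set (ℝ × ℝ)) (g₁ g₂ : Freq → ℂ) (q : SpaceTime)
    (p : Freq × Freq) : ℂ :=
  stChar (p.1 + p.2) q * S.indicator (fun _ => (1 : ℂ)) (p.1.2.1, p.2.2.1) * g₁ p.1 * g₂ p.2

/-- The space-time function
`F(t,z) = ∫ e^{-it(τ₁+τ₂) - iz·(ζ₁+ζ₂)} 1_S(ξ₁,ξ₂) g₁(τ₁,ζ₁) g₂(τ₂,ζ₂) (dζ₁)(dζ₂) dτ₁ dτ₂`. -/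
noncomputable def bilinearProduct (S : Set (ℝ × ℝ)) (g₁ g₂ : Freq → ℂ) (q : SpaceTime) : ℂ :=
  ∫ p, bilinearIntegrand S g₁ g₂ q p ∂(freqMeasure.prod freqMeasure)

/-!
Write `g₁`, `g₂` for the two transforms and put `σ = 1` for the first product, `σ = -1` for the
second. Because the transform of `conj f` is `conj (f̂(-τ,-ζ))` (`stFourier_conj`), the second
factor is controlled in both cases by the weight `⟨τ - σ |ζ|²⟩^{2b}`, the cut-off reads
`|ξ₁ - σ ξ₂| ≥ c M`, and the two estimates are one (`bilinear_estimate`).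

The weights and the bounded spatial frequencies make `g₁`, `g₂` integrable, which gives absolute
convergence. After the substitution `p = p₁ + p₂` the function `F` is the Fourier integral of the
truncated convolution `G` of `g₁` and `g₂`, so `‖F‖² ≤ (2π)³ ‖G‖²` (`besselBound_stChar`). Only this
half of Plancherel's theorem is needed, and only for integrable `G`; it is proved one variable at a
time (`BesselBound.prod`) from its versions on the line and on the circle.

The Cauchy–Schwarz inequality bounds `|G(p)|²` by the convolution of the weighted squares
`⟨·⟩^{2b} |gⱼ|²`, whose integral is `‖f₁‖² ‖f₂‖²` in the `X^{0,b}` norm, times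
`∫ 1_{|ξ₁ - σ ξ₂| ≥ c M} 1_{|η₁| ≤ K N₁} ⟨τ₁ - |ζ₁|²⟩^{-2b} ⟨τ₂ - σ |ζ₂|²⟩^{-2b}` over
`p₁ + p₂ = p`. In the variable `u = τ₁ - |ζ₁|²` the second bracket is that of a quadratic polynomial
in `ξ₁` with derivative `-2 (ξ₁ - σ ξ₂)`, so the `ξ₁` integral is `O(1/M)`, the `u` integral is
finite as `2b > 1`, and the sum over `η₁` has `O(N₁)` terms (`lintegral_resonance_kernel_le`).
Altogether the kernel is `O(N₁ / M)`, uniformly in `p`.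
-/

/-! ### Bessel bounds for the Fourier integral -/

theorem eLpNorm_two_sq {α : Type*} [MeasurableSpace α] (μ : Measure α) (u : α → ℂ) :
    eLpNorm u 2 μ ^ 2 = ∫⁻ x, ‖u x‖ₑ ^ 2 ∂μ := by
  simpa using eLpNorm_nnreal_pow_eq_lintegral (f := u) (μ := μ) (p := 2) (by norm_num)

open scoped FourierTransform ENNReal SchwartzMap in
/-- Half of Plancherel's theorem for `g ∈ L¹`, where `𝓕 g` is the pointwise defined Fourier integral
and both sides may be infinite. If `g ∈ L²`, then `𝓕 g` coincides with the Fourier transform of `g`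
in `L²`, because both represent the same tempered distribution. -/
theorem lintegral_enorm_sq_fourier_le {g : ℝ → ℂ} (hg : Integrable g) :
    ∫⁻ w, ‖𝓕 g w‖ₑ ^ 2 ≤ ∫⁻ v, ‖g v‖ₑ ^ 2 := by
  by_cases hfin : ∫⁻ v, ‖g v‖ₑ ^ 2 = ⊤
  · simp [hfin]
  have hg2 : MemLp g 2 := by
    refine ⟨hg.1, ?_⟩
    rw [← eLpNorm_two_sq] at hfin
    exact lt_top_iff_ne_top.2 fun h => hfin (by simp [h])
  have hcont : Continuous (𝓕 g) :=
    VectorFourier.fourierIntegral_continuous Real.continuous_fourierChar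
      continuous_inner hg
  set G : Lp ℂ 2 (volume : Measure ℝ) := 𝓕 (hg2.toLp g) with hG
  have hae : ∀ᵐ w, G w = 𝓕 g w := by
    refine ae_eq_of_integral_contDiff_smul_eq
      ((Lp.memLp G).locallyIntegrable one_le_two) hcont.locallyIntegrable ?_
    intro φ hφ hφc
    let ψ : 𝓢(ℝ, ℂ) := HasCompactSupport.toSchwartzMap (f := fun x => (φ x : ℂ))
      (hφc.comp_left (g := fun r : ℝ => (r : ℂ)) (by simp)) (Complex.ofRealCLM.contDiff.comp hφ)
    have hψ : ∀ x, ψ x = φ x := fun x => rfl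
    have h1 := congrArg (fun T : 𝓢'(ℝ, ℂ) => T ψ)
      (Lp.fourier_toTemperedDistribution_eq (hg2.toLp g))
    simp only [TemperedDistribution.fourier_apply, Lp.toTemperedDistribution_apply] at h1
    have h2 : ∫ x, 𝓕 ψ x • (hg2.toLp g) x = ∫ x, 𝓕 (ψ : ℝ → ℂ) x • g x := by
      refine integral_congr_ae ?_
      filter_upwards [hg2.coeFn_toLp] with x hx
      rw [hx, SchwartzMap.fourier_coe]
    have h3 := VectorFourier.integral_fourierIntegral_smul_eq_flip (L := innerₗ ℝ)
      Real.continuous_fourierChar continuous_inner (ψ.integrable (μ := volume)) hg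
    simp only [flip_innerₗ] at h3
    have h4 : ∫ x, 𝓕 (ψ : ℝ → ℂ) x • g x = ∫ x, ψ x • 𝓕 g x := h3
    calc ∫ x, φ x • G x = ∫ x, ψ x • G x := by simp [hψ]
      _ = ∫ x, ψ x • 𝓕 g x := by rw [hG, ← h1, h2, h4]
      _ = ∫ x, φ x • 𝓕 g x := by simp [hψ]
  have hn : eLpNorm G 2 volume = eLpNorm g 2 volume := by
    have := Lp.norm_fourier_eq (hg2.toLp g)
    rw [← hG, Lp.norm_def, Lp.norm_toLp] at this
    exact (ENNReal.toReal_eq_toReal_iff' (Lp.eLpNorm_ne_top G) hg2.eLpNorm_ne_top).1 this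
  rw [← eLpNorm_two_sq volume g, ← hn, eLpNorm_two_sq]
  refine (lintegral_congr_ae ?_).le
  filter_upwards [hae] with w hw
  rw [hw]

/-- The kernel `e` maps `L¹(μ) ∩ L²(μ)` to `L²(ν)` with squared norm at most `A`: for every
`g ∈ L¹(μ)`, the absolutely convergent integral `x ↦ ∫ e(p, x) g(p) dμ(p)` has squared `L²(ν)` norm
at most `A ‖g‖²`. The right-hand side may be infinite, so that `g ∈ L²` need not be assumed. -/
def BesselBound {P X : Type*} [MeasurableSpace P] [MeasurableSpace X] (μ : Measure P)
    (ν : Measure X) (e : P → X → ℂ) (A : ENNReal) : Prop :=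
  ∀ g : P → ℂ, Integrable g μ →
    ∫⁻ x, ‖∫ p, e p x * g p ∂μ‖ₑ ^ 2 ∂ν ≤ A * ∫⁻ p, ‖g p‖ₑ ^ 2 ∂μ

open scoped FourierTransform in
/-- On `ℝ` with frequency normalization `e^{-ixp}` the constant is `2π`. -/
theorem besselBound_real :
    BesselBound (volume : Measure ℝ) (volume : Measure ℝ)
      (fun p x => Complex.exp (-(Complex.I * ((x * p : ℝ) : ℂ))))
      (ENNReal.ofReal (2 * Real.pi)) := by
  intro g hg
  have h1 : ∀ x : ℝ, ∫ p, Complex.exp (-(Complex.I * ((x * p : ℝ) : ℂ))) * g p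
      = 𝓕 g ((2 * Real.pi)⁻¹ * x) := by
    intro x
    rw [Real.fourier_real_eq_integral_exp_smul]
    refine integral_congr_ae (Eventually.of_forall fun p => ?_)
    simp only [smul_eq_mul]
    congr 2
    push_cast
    field_simp
  have h2 : ∫⁻ x : ℝ, ‖𝓕 g ((2 * Real.pi)⁻¹ * x)‖ₑ ^ 2
      = ENNReal.ofReal (2 * Real.pi) * ∫⁻ w, ‖𝓕 g w‖ₑ ^ 2 := by
    have hne : (2 * Real.pi)⁻¹ ≠ 0 := inv_ne_zero Real.two_pi_pos.ne'
    have := (Homeomorph.mulLeft₀ _ hne).measurableEmbedding.lintegral_map (μ := volume)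
      (fun w => ‖𝓕 g w‖ₑ ^ 2)
    simp only [Homeomorph.coe_mulLeft₀] at this
    rw [← this, Real.map_volume_mul_left hne, lintegral_smul_measure, smul_eq_mul]
    simp [abs_of_pos Real.pi_pos]
  simp_rw [h1]
  rw [h2]
  exact mul_le_mul_right (lintegral_enorm_sq_fourier_le hg) _

/-- A trigonometric series with absolutely summable coefficients converges in `L²` to its uniform
sum, so that Parseval's identity for the Hilbert basis of characters applies. -/
theorem besselBound_circle :
    BesselBound (Measure.count : Measure ℤ) (volume : Measure (AddCircle (2 * Real.pi)))
      (fun n y => fourier (-n) y) (ENNReal.ofReal (2 * Real.pi)) := by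
  intro a ha
  have hs : Summable fun n => ‖a n‖ := integrable_count_iff.1 ha
  have hs' : Summable fun n => ‖a (-n)‖ := (Equiv.neg ℤ).summable_iff.2 hs
  have hl2 : Memℓp (fun n => a (-n)) 2 := by
    have : Memℓp (fun n => a (-n)) 1 := memℓp_gen (by simpa using hs')
    exact this.of_exponent_ge (by norm_num)
  let α : lp (fun _ : ℤ => ℂ) 2 := ⟨fun n => a (-n), hl2⟩
  have hF : Summable fun n : ℤ => a (-n) • fourier (T := 2 * Real.pi) n := by
    refine Summable.of_norm ?_
    simpa [norm_smul, fourier_norm] using hs'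
  set F : C(AddCircle (2 * Real.pi), ℂ) := ∑' n : ℤ, a (-n) • fourier n with hFdef
  have hFv : ∀ y, ∫ n, fourier (-n) y * a n ∂Measure.count = F y := by
    intro y
    have h1 : HasSum (fun n : ℤ => a (-n) * fourier n y) (F y) := by
      simpa using (ContinuousMap.evalCLM ℂ y).hasSum hF.hasSum
    have h2 : HasSum (fun n : ℤ => fourier (-n) y * a n) (F y) := by
      rw [← (Equiv.neg ℤ).hasSum_iff]
      convert h1 using 2 with n
      simp only [Function.comp, Equiv.neg_apply, neg_neg]
      ring
    rw [← h2.tsum_eq, integral_countable]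
    · simp [Measure.real]
    · rw [integrable_count_iff]
      exact h2.summable.norm
  have hLp : ContinuousMap.toLp 2 AddCircle.haarAddCircle ℂ F =
      (fourierBasis (T := 2 * Real.pi)).repr.symm α := by
    have h1 := (ContinuousMap.toLp (E := ℂ) 2 (AddCircle.haarAddCircle (T := 2 * Real.pi)) ℂ).hasSum
      hF.hasSum
    have h2 := (fourierBasis (T := 2 * Real.pi)).hasSum_repr_symm α
    rw [coe_fourierBasis] at h2
    refine h1.unique ?_
    simpa [α, fourierLp] using h2
  have hnorm : eLpNorm F 2 AddCircle.haarAddCircle ^ 2 = ∫⁻ n, ‖a n‖ₑ ^ 2 ∂Measure.count := by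
    have h1 : eLpNorm F 2 (AddCircle.haarAddCircle (T := 2 * Real.pi)) = ENNReal.ofReal ‖α‖ := by
      rw [← LinearIsometryEquiv.norm_map (fourierBasis (T := 2 * Real.pi)).repr.symm α, ← hLp,
        ofReal_norm, Lp.enorm_def]
      exact eLpNorm_congr_ae (ContinuousMap.coeFn_toLp _ F).symm
    have h2 := lp.hasSum_norm (p := 2) (by norm_num) α
    simp only [ENNReal.toReal_ofNat, Real.rpow_ofNat] at h2
    rw [h1, ← ENNReal.ofReal_pow (norm_nonneg _), ← h2.tsum_eq,
      ENNReal.ofReal_tsum_of_nonneg (fun _ => by positivity) h2.summable, lintegral_count,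
      ← (Equiv.neg ℤ).tsum_eq]
    refine tsum_congr fun n => ?_
    simp [α, ENNReal.ofReal_pow, ofReal_norm]
  simp_rw [hFv]
  rw [AddCircle.volume_eq_smul_haarAddCircle, lintegral_smul_measure, ← hnorm,
    smul_eq_mul]
  rw [eLpNorm_two_sq]

/-- Bessel bounds tensorize: transform one variable at a time. This only uses that the partial
transform of an integrable function is integrable in the remaining variable; it need not be square
integrable, since the bounds hold in `[0,∞]`. -/
theorem BesselBound.prod {P₁ P₂ X₁ X₂ : Type*} [MeasurableSpace P₁] [MeasurableSpace P₂]
    [MeasurableSpace X₁] [MeasurableSpace X₂] {μ₁ : Measure P₁} {μ₂ : Measure P₂}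
    {ν₁ : Measure X₁} {ν₂ : Measure X₂} [SFinite μ₁] [SFinite μ₂] [SFinite ν₁] [SFinite ν₂]
    {e₁ : P₁ → X₁ → ℂ} {e₂ : P₂ → X₂ → ℂ} {A₁ A₂ : ENNReal}
    (m₁ : Measurable fun z : P₁ × X₁ => e₁ z.1 z.2) (m₂ : Measurable fun z : P₂ × X₂ => e₂ z.1 z.2)
    (b₁ : ∀ p x, ‖e₁ p x‖ ≤ 1) (b₂ : ∀ p x, ‖e₂ p x‖ ≤ 1)
    (h₁ : BesselBound μ₁ ν₁ e₁ A₁) (h₂ : BesselBound μ₂ ν₂ e₂ A₂) :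
    BesselBound (μ₁.prod μ₂) (ν₁.prod ν₂) (fun p x => e₁ p.1 x.1 * e₂ p.2 x.2) (A₁ * A₂) := by
  suffices H : ∀ g : P₁ × P₂ → ℂ, StronglyMeasurable g → Integrable g (μ₁.prod μ₂) →
      ∫⁻ x, ‖∫ p, e₁ p.1 x.1 * e₂ p.2 x.2 * g p ∂(μ₁.prod μ₂)‖ₑ ^ 2 ∂(ν₁.prod ν₂)
        ≤ A₁ * A₂ * ∫⁻ p, ‖g p‖ₑ ^ 2 ∂(μ₁.prod μ₂) by
    intro g hg
    have hae := hg.1.ae_eq_mk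
    have := H _ hg.1.stronglyMeasurable_mk (hg.congr hae)
    have e1 : ∀ x : X₁ × X₂, ∫ p, e₁ p.1 x.1 * e₂ p.2 x.2 * g p ∂(μ₁.prod μ₂)
        = ∫ p, e₁ p.1 x.1 * e₂ p.2 x.2 * hg.1.mk g p ∂(μ₁.prod μ₂) := fun x =>
      integral_congr_ae (by filter_upwards [hae] with p hp; rw [hp])
    have e2 : ∫⁻ p, ‖g p‖ₑ ^ 2 ∂(μ₁.prod μ₂) = ∫⁻ p, ‖hg.1.mk g p‖ₑ ^ 2 ∂(μ₁.prod μ₂) :=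
      lintegral_congr_ae (by filter_upwards [hae] with p hp; rw [hp])
    simp_rw [e1, e2]
    exact this
  intro g hgm hg
  have s₁ := m₁.stronglyMeasurable
  have s₂ := m₂.stronglyMeasurable
  -- the transform of `g` in the second variable alone
  let H : P₁ → X₂ → ℂ := fun p x => ∫ r, e₂ r x * g (p, r) ∂μ₂
  have hHm : StronglyMeasurable fun z : P₁ × X₂ => H z.1 z.2 := by
    refine StronglyMeasurable.integral_prod_right
      (f := fun (z : P₁ × X₂) (r : P₂) => e₂ r z.2 * g (z.1, r)) ?_
    exact (s₂.comp_measurable (measurable_snd.prodMk (measurable_snd.comp measurable_fst))).mul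
      (hgm.comp_measurable ((measurable_fst.comp measurable_fst).prodMk measurable_snd))
  have hI2 : ∀ x, Integrable (fun p : P₁ × P₂ => e₂ p.2 x * g p) (μ₁.prod μ₂) := fun x =>
    hg.bdd_mul (c := 1) (s₂.comp_measurable
      (measurable_snd.prodMk measurable_const)).aestronglyMeasurable
      (Eventually.of_forall fun p => b₂ _ _)
  have hI1 : ∀ x : X₁ × X₂, Integrable (fun p : P₁ × P₂ => e₁ p.1 x.1 * e₂ p.2 x.2 * g p)
      (μ₁.prod μ₂) := fun x => by
    simp_rw [mul_assoc]
    exact (hI2 x.2).bdd_mul (c := 1) (s₁.comp_measurable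
      (measurable_fst.prodMk measurable_const)).aestronglyMeasurable
      (Eventually.of_forall fun p => b₁ _ _)
  have hHI : ∀ x, Integrable (fun p => H p x) μ₁ := fun x => (hI2 x).integral_prod_left
  have hfub : ∀ x : X₁ × X₂, ∫ p, e₁ p.1 x.1 * e₂ p.2 x.2 * g p ∂(μ₁.prod μ₂)
      = ∫ p, e₁ p x.1 * H p x.2 ∂μ₁ := fun x => by
    rw [integral_prod _ (hI1 x)]
    refine integral_congr_ae (Eventually.of_forall fun p => ?_)
    simp only [H, mul_assoc]
    rw [integral_const_mul]
  have hTm : Measurable fun x : X₁ × X₂ => ‖∫ p, e₁ p x.1 * H p x.2 ∂μ₁‖ₑ ^ 2 := by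
    have : StronglyMeasurable fun x : X₁ × X₂ => ∫ p, e₁ p x.1 * H p x.2 ∂μ₁ := by
      refine StronglyMeasurable.integral_prod_right
        (f := fun (x : X₁ × X₂) (p : P₁) => e₁ p x.1 * H p x.2) ?_
      exact (s₁.comp_measurable (measurable_snd.prodMk (measurable_fst.comp measurable_fst))).mul
        (hHm.comp_measurable (measurable_snd.prodMk (measurable_snd.comp measurable_fst)))
    exact this.measurable.enorm.pow_const 2
  simp_rw [hfub]
  rw [lintegral_prod_symm _ hTm.aemeasurable]
  calc ∫⁻ y, ∫⁻ x, ‖∫ p, e₁ p x * H p y ∂μ₁‖ₑ ^ 2 ∂ν₁ ∂ν₂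
      ≤ ∫⁻ y, A₁ * ∫⁻ p, ‖H p y‖ₑ ^ 2 ∂μ₁ ∂ν₂ :=
        lintegral_mono fun y => h₁ _ (hHI y)
    _ = A₁ * ∫⁻ p, ∫⁻ y, ‖H p y‖ₑ ^ 2 ∂ν₂ ∂μ₁ := by
        have hm : Measurable fun z : P₁ × X₂ => ‖H z.1 z.2‖ₑ ^ 2 := hHm.measurable.enorm.pow_const 2
        rw [lintegral_const_mul, lintegral_lintegral_swap]
        · exact (hm.comp measurable_swap).aemeasurable
        · exact (hm.comp measurable_swap).lintegral_prod_right'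
    _ ≤ A₁ * ∫⁻ p, A₂ * ∫⁻ r, ‖g (p, r)‖ₑ ^ 2 ∂μ₂ ∂μ₁ := by
        refine mul_le_mul_right (lintegral_mono_ae ?_) _
        filter_upwards [hg.prod_right_ae] with p hp
        exact h₂ _ hp
    _ = A₁ * A₂ * ∫⁻ p, ‖g p‖ₑ ^ 2 ∂(μ₁.prod μ₂) := by
        have hm : Measurable fun z : P₁ × P₂ => ‖g z‖ₑ ^ 2 := hgm.measurable.enorm.pow_const 2
        rw [lintegral_prod _ hm.aemeasurable, lintegral_const_mul, mul_assoc]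
        exact hm.lintegral_prod_right'

theorem measurable_fourier_neg :
    Measurable fun z : ℤ × AddCircle (2 * Real.pi) => (fourier (-z.1) z.2 : ℂ) :=
  measurable_from_prod_countable_right fun n => (fourier (-n)).continuous.measurable

theorem measurable_stChar : Measurable fun z : Freq × SpaceTime => stChar z.1 z.2 := by
  unfold stChar
  refine Measurable.mul (by fun_prop) ?_
  exact measurable_fourier_neg.comp
    (by fun_prop : Measurable fun z : Freq × SpaceTime => (z.1.2.2, z.2.2.2))

theorem norm_stChar (p : Freq) (q : SpaceTime) : ‖stChar p q‖ = 1 := by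
  have h : ‖(fourier (-p.2.2) q.2.2 : ℂ)‖ = 1 := Circle.norm_coe _
  rw [stChar, norm_mul, h]
  simp [Complex.norm_exp]

theorem besselBound_stChar :
    BesselBound freqMeasure (volume : Measure SpaceTime) stChar
      (ENNReal.ofReal ((2 * Real.pi) ^ 3)) := by
  have hm : Measurable fun z : ℝ × ℝ => Complex.exp (-(Complex.I * ((z.2 * z.1 : ℝ) : ℂ))) := by
    fun_prop
  have hb : ∀ p x : ℝ, ‖Complex.exp (-(Complex.I * ((x * p : ℝ) : ℂ)))‖ ≤ 1 := fun p x => by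
    simp [Complex.norm_exp]
  have hmc := measurable_fourier_neg
  have hbc : ∀ (n : ℤ) (y : AddCircle (2 * Real.pi)), ‖(fourier (-n) y : ℂ)‖ ≤ 1 := fun n y =>
    (Circle.norm_coe _).le
  have h := besselBound_real.prod (A₂ := _) hm (?_) hb ?_
    (besselBound_real.prod hm hmc hb hbc besselBound_circle)
  · have e : stChar = fun p q => Complex.exp (-(Complex.I * ((q.1 * p.1 : ℝ) : ℂ))) *
      (Complex.exp (-(Complex.I * ((q.2.1 * p.2.1 : ℝ) : ℂ))) * fourier (-p.2.2) q.2.2) := by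
      ext p q
      rw [stChar, ← mul_assoc, ← Complex.exp_add]
      congr 2
      push_cast
      ring
    have hA : ENNReal.ofReal ((2 * Real.pi) ^ 3) = ENNReal.ofReal (2 * Real.pi) *
        (ENNReal.ofReal (2 * Real.pi) * ENNReal.ofReal (2 * Real.pi)) := by
      have := Real.two_pi_pos.le
      rw [← ENNReal.ofReal_mul this, ← ENNReal.ofReal_mul this]
      congr 1
      ring
    rw [e, hA]
    exact h
  · exact (hm.comp (by fun_prop : Measurable fun z : (ℝ × ℤ) × (ℝ × AddCircle (2 * Real.pi)) =>
      (z.1.1, z.2.1))).mul (hmc.comp (by fun_prop : Measurable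
      fun z : (ℝ × ℤ) × (ℝ × AddCircle (2 * Real.pi)) => (z.1.2, z.2.2)))
  · intro p x
    rw [norm_mul]
    exact mul_le_one₀ (hb _ _) (norm_nonneg _) (hbc _ _)

/-! ### The resonance kernel -/

/-- Substituting `v = φ(x)` gains the reciprocal of a lower bound for `|φ'|`. -/
theorem setLIntegral_comp_le_of_le_abs_deriv {s : Set ℝ} (hs : MeasurableSet s) {φ φ' : ℝ → ℝ}
    {m : ℝ} (hm : 0 < m) (hd : ∀ x ∈ s, HasDerivWithinAt φ (φ' x) s x) (hinj : Set.InjOn φ s)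
    (hφ : ∀ x ∈ s, m ≤ |φ' x|) (h : ℝ → ENNReal) :
    ∫⁻ x in s, h (φ x) ≤ (ENNReal.ofReal m)⁻¹ * ∫⁻ v, h v := by
  have hm0 : ENNReal.ofReal m ≠ 0 := by simpa using hm
  calc ∫⁻ x in s, h (φ x)
      ≤ ∫⁻ x in s, (ENNReal.ofReal m)⁻¹ * (ENNReal.ofReal |φ' x| * h (φ x)) := by
        refine setLIntegral_mono' hs fun x hx => ?_
        rw [← mul_assoc]
        refine le_mul_of_one_le_left zero_le ?_
        rw [← ENNReal.inv_mul_cancel hm0 ENNReal.ofReal_ne_top]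
        gcongr
        exact hφ x hx
    _ = (ENNReal.ofReal m)⁻¹ * ∫⁻ v in φ '' s, h v := by
        rw [lintegral_const_mul' _ _ (ENNReal.inv_ne_top.2 hm0),
          lintegral_image_eq_lintegral_abs_deriv_mul hs hd hinj]
    _ ≤ _ := by
        exact mul_le_mul_right (setLIntegral_le_lintegral _ _) _

/-- The phase has derivative `-2 (x - σ (ξ - x))`, of size at least `2D` on the domain of
integration, and is injective on each of the two pieces on which the derivative has a fixed sign. -/
theorem setLIntegral_quadratic_phase_le {D : ℝ} (hD : 0 < D) (σ ξ α : ℝ) (h : ℝ → ENNReal) :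
    ∫⁻ x in {x : ℝ | D ≤ |x - σ * (ξ - x)|}, h (α - x ^ 2 - σ * (ξ - x) ^ 2)
      ≤ (ENNReal.ofReal D)⁻¹ * ∫⁻ v, h v := by
  have half : ∀ s : ℝ, |s| = 1 →
      ∫⁻ x in {x : ℝ | D ≤ s * (x - σ * (ξ - x))}, h (α - x ^ 2 - σ * (ξ - x) ^ 2)
        ≤ (ENNReal.ofReal (2 * D))⁻¹ * ∫⁻ v, h v := by
    intro s hs
    refine setLIntegral_comp_le_of_le_abs_deriv (φ := fun x => α - x ^ 2 - σ * (ξ - x) ^ 2)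
      (φ' := fun x => -2 * (x - σ * (ξ - x)))
      (measurableSet_le measurable_const (by fun_prop)) (by positivity) ?_ ?_ ?_ h
    · intro x _
      refine HasDerivAt.hasDerivWithinAt ?_
      have h1 : HasDerivAt (fun y : ℝ => y ^ 2) (2 * x) x := by simpa using hasDerivAt_pow 2 x
      have h2 : HasDerivAt (fun y : ℝ => (ξ - y) ^ 2) (-(2 * (ξ - x))) x := by
        simpa using ((hasDerivAt_id' x).const_sub ξ).fun_pow 2
      exact ((h1.const_sub α).fun_sub (h2.const_mul σ)).congr_deriv (by ring)
    · intro x hx y hy hxy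
      simp only [Set.mem_ofPred_eq] at hx hy hxy
      -- `φ y - φ x` factors, and the second factor is at least `2D` in absolute value
      have h0 : (x - y) * ((x - σ * (ξ - x)) + (y - σ * (ξ - y))) = 0 := by linear_combination -hxy
      rcases mul_eq_zero.1 h0 with h1 | h1
      · linarith
      · have : s * ((x - σ * (ξ - x)) + (y - σ * (ξ - y))) = 0 := by rw [h1, mul_zero]
        linarith
    · intro x hx
      simp only [Set.mem_ofPred_eq] at hx
      have : D ≤ |x - σ * (ξ - x)| := by
        calc D ≤ |s * (x - σ * (ξ - x))| := hx.trans (le_abs_self _)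
          _ = _ := by rw [abs_mul, hs, one_mul]
      rw [abs_mul]
      norm_num
      exact this
  have hsub : {x : ℝ | D ≤ |x - σ * (ξ - x)|} ⊆
      {x | D ≤ 1 * (x - σ * (ξ - x))} ∪ {x | D ≤ -1 * (x - σ * (ξ - x))} := by
    intro x hx
    simpa [le_abs] using hx
  calc _ ≤ _ := lintegral_mono_set hsub
    _ ≤ _ := lintegral_union_le _ _ _
    _ ≤ _ := add_le_add (half 1 (by simp)) (half (-1) (by simp))
    _ = _ := by
      rw [← two_mul, ← mul_assoc, ENNReal.ofReal_mul zero_le_two,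
        ENNReal.mul_inv (by simp) (by simp), ← mul_assoc, ENNReal.ofReal_ofNat,
        ENNReal.mul_inv_cancel (by simp) (by simp), one_mul]

theorem count_abs_le (R : ℝ) (hR : 0 ≤ R) :
    Measure.count {n : ℤ | |(n : ℝ)| ≤ R} ≤ ENNReal.ofReal (2 * R + 1) := by
  have hsub : {n : ℤ | |(n : ℝ)| ≤ R} ⊆ (Finset.Icc (-⌊R⌋) ⌊R⌋ : Finset ℤ) := by
    intro n hn
    simp only [Set.mem_ofPred_eq, abs_le] at hn
    simp only [Finset.coe_Icc, Set.mem_Icc]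
    refine ⟨?_, Int.le_floor.2 hn.2⟩
    have : -n ≤ ⌊R⌋ := Int.le_floor.2 (by push_cast; linarith)
    linarith
  have hfl : 0 ≤ ⌊R⌋ := Int.floor_nonneg.2 hR
  refine (measure_mono hsub).trans ?_
  rw [Measure.count_apply_finset, Int.card_Icc, ← ENNReal.ofReal_natCast]
  refine ENNReal.ofReal_le_ofReal ?_
  have : (((⌊R⌋ + 1 - -⌊R⌋).toNat : ℕ) : ℤ) = ⌊R⌋ + 1 - -⌊R⌋ := Int.toNat_of_nonneg (by linarith)
  have h2 : (((⌊R⌋ + 1 - -⌊R⌋).toNat : ℕ) : ℝ) = ⌊R⌋ + 1 - -⌊R⌋ := by exact_mod_cast this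
  rw [h2]
  linarith [Int.floor_le R]

instance sFinite_freqMeasure : SFinite freqMeasure := by
  unfold freqMeasure; infer_instance

instance isAddLeftInvariant_freqMeasure : freqMeasure.IsAddLeftInvariant := by
  unfold freqMeasure; infer_instance

theorem measurePreserving_neg_freqMeasure :
    MeasurePreserving (fun p : Freq => -p) freqMeasure freqMeasure :=
   (Measure.measurePreserving_neg volume).prod
    ((Measure.measurePreserving_neg volume).prod (Measure.measurePreserving_neg Measure.count))

theorem spatialLength_sq (p : Freq) : spatialLength p ^ 2 = p.2.1 ^ 2 + (p.2.2 : ℝ) ^ 2 :=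
  Real.sq_sqrt (by positivity)

theorem measurable_spatialLength : Measurable spatialLength := by
  unfold spatialLength
  have : Measurable fun p : Freq => (p.2.2 : ℝ) :=
    (measurable_from_top (f := fun n : ℤ => (n : ℝ))).comp (by fun_prop)
  fun_prop

theorem abs_fst_le_spatialLength (p : Freq) : |p.2.1| ≤ spatialLength p :=
  Real.abs_le_sqrt (le_add_of_nonneg_right (sq_nonneg _))

theorem abs_snd_le_spatialLength (p : Freq) : |(p.2.2 : ℝ)| ≤ spatialLength p :=
  Real.abs_le_sqrt (le_add_of_nonneg_left (sq_nonneg _))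

/-- The bound on the resonant set that drives the bilinear estimate. With `r = ζ₁` and
`p - r = ζ₂`, the substitution `u = τ₁ - |ζ₁|²` makes the first factor independent of `ξ₁`. For
fixed `u` and `η₁` the integral over `ξ₁` is at most `J / D`, then the integral over `u` gives `J`,
and the number of `η₁` is at most `2R + 1`. -/
theorem lintegral_resonance_kernel_le {D R : ℝ} (hD : 0 < D) (hR : 0 ≤ R) (σ : ℝ)
    {h : ℝ → ENNReal} (hh : Measurable h) (p : Freq) :
    ∫⁻ r : Freq, {x : ℝ | D ≤ |x - σ * (p.2.1 - x)|}.indicator 1 r.2.1 *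
        {n : ℤ | |(n : ℝ)| ≤ R}.indicator 1 r.2.2 *
        (h (r.1 - spatialLength r ^ 2) * h ((p - r).1 - σ * spatialLength (p - r) ^ 2))
        ∂freqMeasure
      ≤ ENNReal.ofReal (2 * R + 1) * ((ENNReal.ofReal D)⁻¹ * (∫⁻ v, h v) ^ 2) := by
  set J := ∫⁻ v, h v with hJ
  set S : Set ℝ := {x : ℝ | D ≤ |x - σ * (p.2.1 - x)|} with hS
  set T : Set ℤ := {n : ℤ | |(n : ℝ)| ≤ R} with hT
  have hSm : MeasurableSet S := measurableSet_le measurable_const (by fun_prop)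
  have hTm : MeasurableSet T := MeasurableSet.of_discrete
  have hSi : Measurable (S.indicator (1 : ℝ → ENNReal)) := measurable_one.indicator hSm
  have hTi : Measurable (T.indicator (1 : ℤ → ENNReal)) := measurable_one.indicator hTm
  have hL := measurable_spatialLength
  have hkm : Measurable fun r : Freq => S.indicator 1 r.2.1 * T.indicator 1 r.2.2 *
      (h (r.1 - spatialLength r ^ 2) * h ((p - r).1 - σ * spatialLength (p - r) ^ 2)) := by
    fun_prop
  rw [freqMeasure, lintegral_prod_symm _ hkm.aemeasurable]
  -- the substitution `u = t - |ζ|²` in the time frequency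
  have hτ : ∀ z : ℝ × ℤ, ∫⁻ t : ℝ, S.indicator 1 z.1 * T.indicator 1 z.2 *
      (h (t - spatialLength (t, z) ^ 2) *
        h ((p - (t, z)).1 - σ * spatialLength (p - (t, z)) ^ 2)) =
      ∫⁻ u : ℝ, S.indicator 1 z.1 * T.indicator 1 z.2 * (h u *
        h ((p.1 - u - (z.2 : ℝ) ^ 2 - σ * ((p.2.2 - z.2 : ℤ) : ℝ) ^ 2) - z.1 ^ 2
          - σ * (p.2.1 - z.1) ^ 2)) := by
    intro z
    symm
    rw [← lintegral_sub_right_eq_self _ (z.1 ^ 2 + (z.2 : ℝ) ^ 2)]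
    refine lintegral_congr fun t => ?_
    simp only [spatialLength_sq, Prod.fst_sub, Prod.snd_sub]
    congr 3
    ring
  simp_rw [hτ]
  have hcast : Measurable fun n : ℤ => (n : ℝ) := measurable_from_top
  have hm3 : Measurable fun w : (ℝ × ℤ) × ℝ => S.indicator 1 w.1.1 * T.indicator 1 w.1.2 *
      (h w.2 * h ((p.1 - w.2 - (w.1.2 : ℝ) ^ 2 - σ * ((p.2.2 - w.1.2 : ℤ) : ℝ) ^ 2) - w.1.1 ^ 2
          - σ * (p.2.1 - w.1.1) ^ 2)) := by
    fun_prop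
  rw [lintegral_prod_symm _ hm3.lintegral_prod_right'.aemeasurable]
  calc _ ≤ ∫⁻ n : ℤ, T.indicator 1 n * ((ENNReal.ofReal D)⁻¹ * J ^ 2) ∂Measure.count := ?_
    _ = Measure.count T * ((ENNReal.ofReal D)⁻¹ * J ^ 2) := by
        rw [lintegral_mul_const _ hTi, lintegral_indicator_one hTm]
    _ ≤ _ := by
        gcongr
        exact count_abs_le R hR
  refine lintegral_mono fun n => ?_
  rw [lintegral_lintegral_swap (by
    exact (hm3.comp (by fun_prop : Measurable fun w : ℝ × ℝ => ((w.1, n), w.2))).aemeasurable)]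
  calc _ = ∫⁻ u : ℝ, T.indicator 1 n * (h u * ∫⁻ x in S,
        h ((p.1 - u - (n : ℝ) ^ 2 - σ * ((p.2.2 - n : ℤ) : ℝ) ^ 2) - x ^ 2
          - σ * (p.2.1 - x) ^ 2)) := by
        refine lintegral_congr fun u => ?_
        rw [← lintegral_indicator hSm, ← lintegral_const_mul _ (by
            exact Measurable.indicator (by fun_prop) hSm),
          ← lintegral_const_mul _ (by
            exact (Measurable.indicator (by fun_prop) hSm).const_mul _)]
        refine lintegral_congr fun x => ?_
        by_cases hx : x ∈ S <;> simp [hx]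
    _ ≤ ∫⁻ u : ℝ, T.indicator 1 n * (h u * ((ENNReal.ofReal D)⁻¹ * J)) := by
        refine lintegral_mono fun u => ?_
        gcongr
        exact setLIntegral_quadratic_phase_le hD _ _ _ _
    _ = T.indicator 1 n * ((ENNReal.ofReal D)⁻¹ * J ^ 2) := by
        rw [lintegral_const_mul _ (by fun_prop), lintegral_mul_const _ hh]
        ring

/-! ### The bilinear estimate for measurable functions of frequency -/

theorem sq_lintegral_mul_le {α : Type*} [MeasurableSpace α] (μ : Measure α) {f g : α → ENNReal}
    (hf : AEMeasurable f μ) (hg : AEMeasurable g μ) :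
    (∫⁻ x, f x * g x ∂μ) ^ 2 ≤ (∫⁻ x, f x ^ 2 ∂μ) * ∫⁻ x, g x ^ 2 ∂μ := by
  have h := ENNReal.lintegral_mul_le_Lp_mul_Lq μ Real.HolderConjugate.two_two hf hg
  simp only [Pi.mul_apply, ENNReal.rpow_ofNat] at h
  refine (pow_le_pow_left₀ zero_le h 2).trans (le_of_eq ?_)
  rw [mul_pow, ← ENNReal.rpow_natCast, ← ENNReal.rpow_natCast, ← ENNReal.rpow_mul,
    ← ENNReal.rpow_mul]
  norm_num

theorem japaneseBracket_pos (r : ℝ) : 0 < japaneseBracket r :=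
  Real.sqrt_pos.2 (by positivity)

theorem measurable_japaneseBracket : Measurable japaneseBracket := by
  unfold japaneseBracket
  fun_prop

/-- The power `⟨r⟩^b` of the Japanese bracket, with values in `[0,∞]`. -/
noncomputable def bracketWeight (b r : ℝ) : ENNReal := ENNReal.ofReal (japaneseBracket r ^ b)

theorem measurable_bracketWeight (b : ℝ) : Measurable (bracketWeight b) :=
  (measurable_japaneseBracket.pow_const b).ennreal_ofReal

theorem bracketWeight_sq (b r : ℝ) : bracketWeight b r ^ 2 = bracketWeight (2 * b) r := by
  have := (japaneseBracket_pos r).le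
  rw [bracketWeight, bracketWeight, ← ENNReal.ofReal_pow (by positivity),
    ← Real.rpow_mul_natCast this]
  congr 2
  push_cast
  ring

theorem bracketWeight_neg_mul (b r : ℝ) : bracketWeight (-b) r * bracketWeight b r = 1 := by
  have := japaneseBracket_pos r
  rw [bracketWeight, bracketWeight, ← ENNReal.ofReal_mul (by positivity), ← Real.rpow_add this]
  simp

theorem lintegral_bracketWeight_lt_top {b : ℝ} (hb : 1 / 2 < b) :
    ∫⁻ v, bracketWeight (2 * -b) v < ⊤ := by
  have h := integrable_rpow_neg_one_add_norm_sq (E := ℝ) (μ := volume) (r := 2 * b)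
    (by simp; linarith)
  refine lt_of_eq_of_lt (lintegral_congr fun v => ?_) h.hasFiniteIntegral
  have h1 : 0 ≤ 1 + v ^ 2 := by positivity
  simp only [Real.norm_eq_abs, sq_abs]
  rw [bracketWeight, japaneseBracket, Real.sqrt_eq_rpow, ← Real.rpow_mul h1,
    Real.enorm_of_nonneg (by positivity)]
  congr 2
  ring

/-- The squared norm `∫ ∫ ⟨τ - σ |ζ|²⟩^{2b} |g(τ,ζ)|² dτ (dζ)`. For `σ = 1` this is the squared
`X^{0,b}` norm on the Fourier side; for `σ = -1` it is the one that the transforms of complex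
conjugates of functions in `X^{0,b}` have finite. -/
noncomputable def twistedNormSq (σ b : ℝ) (g : Freq → ℂ) : ENNReal :=
  ∫⁻ p, bracketWeight (2 * b) (p.1 - σ * spatialLength p ^ 2) * ‖g p‖ₑ ^ 2 ∂freqMeasure

theorem lintegral_bracketWeight_of_spatialLength_le_lt_top {b : ℝ} (hb : 1 / 2 < b) (σ : ℝ) {R : ℝ}
    (hR : 0 ≤ R) :
    ∫⁻ p, {p : Freq | spatialLength p ≤ R}.indicator 1 p *
      bracketWeight (2 * -b) (p.1 - σ * spatialLength p ^ 2) ∂freqMeasure < ⊤ := by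
  have hL := measurable_spatialLength
  have hw := measurable_bracketWeight (2 * -b)
  have hsub : {p : Freq | spatialLength p ≤ R} ⊆
      Set.univ ×ˢ (Set.Icc (-R) R ×ˢ {n : ℤ | |(n : ℝ)| ≤ R}) := by
    intro p hp
    have hp' : spatialLength p ≤ R := hp
    exact ⟨trivial, abs_le.1 ((abs_fst_le_spatialLength p).trans hp'),
      (abs_snd_le_spatialLength p).trans hp'⟩
  set A : Set (ℝ × ℤ) := Set.Icc (-R) R ×ˢ {n : ℤ | |(n : ℝ)| ≤ R} with hA
  have hAm : MeasurableSet A := measurableSet_Icc.prod .of_discrete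
  calc _ ≤ ∫⁻ p : Freq, A.indicator 1 p.2 *
        bracketWeight (2 * -b) (p.1 - σ * spatialLength p ^ 2) ∂freqMeasure := by
        refine lintegral_mono fun p => ?_
        gcongr
        by_cases hp : p ∈ {p : Freq | spatialLength p ≤ R}
        · have hpA : p.2 ∈ A := (hsub hp).2
          simp [hp, hpA]
        · simp [hp]
    _ = ∫⁻ z : ℝ × ℤ, A.indicator 1 z * (∫⁻ v, bracketWeight (2 * -b) v)
          ∂((volume : Measure ℝ).prod Measure.count) := by
        have hAi : Measurable (A.indicator (1 : ℝ × ℤ → ENNReal)) := measurable_one.indicator hAm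
        rw [freqMeasure, lintegral_prod_symm _ (by fun_prop)]
        refine lintegral_congr fun z => ?_
        simp only [spatialLength_sq]
        rw [lintegral_const_mul _ (by fun_prop),
          lintegral_sub_right_eq_self (bracketWeight (2 * -b))]
    _ < ⊤ := by
        rw [lintegral_mul_const _ (measurable_one.indicator hAm), lintegral_indicator_one hAm, hA,
          Measure.prod_prod]
        refine ENNReal.mul_lt_top (ENNReal.mul_lt_top (by simp) ?_)
          (lintegral_bracketWeight_lt_top hb)
        exact (count_abs_le R hR).trans_lt ENNReal.ofReal_lt_top

/-- By the Cauchy–Schwarz inequality, since `⟨τ - σ |ζ|²⟩^{-2b}` is integrable over `|ζ| ≤ R`. This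
is the source of absolute convergence. -/
theorem integrable_of_twistedNormSq_lt_top {b : ℝ} (hb : 1 / 2 < b) {σ R : ℝ} (hR : 0 ≤ R)
    {g : Freq → ℂ} (hg : Measurable g) (hs : ∀ᵐ p ∂freqMeasure, g p ≠ 0 → spatialLength p ≤ R)
    (hX : twistedNormSq σ b g < ⊤) : Integrable g freqMeasure := by
  refine ⟨hg.aestronglyMeasurable, ?_⟩
  have hL := measurable_spatialLength
  have hw := measurable_bracketWeight
  have hB : MeasurableSet {p : Freq | spatialLength p ≤ R} := measurableSet_le hL measurable_const
  have hBi : Measurable ({p : Freq | spatialLength p ≤ R}.indicator (1 : Freq → ENNReal)) :=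
    measurable_one.indicator hB
  have hcs := sq_lintegral_mul_le freqMeasure
    (f := fun p => {p : Freq | spatialLength p ≤ R}.indicator 1 p *
      bracketWeight (-b) (p.1 - σ * spatialLength p ^ 2))
    (g := fun p => bracketWeight b (p.1 - σ * spatialLength p ^ 2) * ‖g p‖ₑ)
    (by fun_prop) (by fun_prop)
  have hlt := hcs.trans_lt (b := _) (c := ⊤) (ENNReal.mul_lt_top ?_ ?_)
  · rw [HasFiniteIntegral]
    refine lt_of_le_of_lt (lintegral_mono_ae ?_)
      (lt_top_iff_ne_top.2 fun h => hlt.ne (by rw [h]; rfl))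
    filter_upwards [hs] with p hp
    by_cases h0 : g p = 0
    · simp [h0]
    · rw [mul_assoc, ← mul_assoc (bracketWeight (-b) _), bracketWeight_neg_mul]
      simp [hp h0]
  · refine lt_of_eq_of_lt (lintegral_congr fun p => ?_)
      (lintegral_bracketWeight_of_spatialLength_le_lt_top hb σ hR)
    rw [mul_pow, bracketWeight_sq]
    congr 1
    by_cases h : p ∈ {p : Freq | spatialLength p ≤ R} <;> simp [h]
  · refine lt_of_eq_of_lt (lintegral_congr fun p => ?_) hX
    rw [mul_pow, bracketWeight_sq]

/-- The Cauchy–Schwarz inequality on the slice `ζ₁ + ζ₂ = p`, with the weights `⟨·⟩^{-b} ⟨·⟩^b`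
inserted. -/
theorem enorm_integral_slice_sq_le {b D R : ℝ} (hD : 0 < D) (hR : 0 ≤ R) (σ : ℝ)
    {g₁ g₂ : Freq → ℂ} (hg₁ : Measurable g₁) (hg₂ : Measurable g₂)
    (hs : ∀ᵐ r ∂freqMeasure, g₁ r ≠ 0 → spatialLength r ≤ R) (p : Freq) :
    ‖∫ r, {x : ℝ × ℝ | D ≤ |x.1 - σ * x.2|}.indicator (fun _ => (1 : ℂ)) (r.2.1, (p - r).2.1) *
        g₁ r * g₂ (p - r) ∂freqMeasure‖ₑ ^ 2
      ≤ ENNReal.ofReal (2 * R + 1) *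
          ((ENNReal.ofReal D)⁻¹ * (∫⁻ v, bracketWeight (2 * -b) v) ^ 2) *
        ∫⁻ r, bracketWeight (2 * b) (r.1 - 1 * spatialLength r ^ 2) * ‖g₁ r‖ₑ ^ 2 *
          (bracketWeight (2 * b) ((p - r).1 - σ * spatialLength (p - r) ^ 2) *
            ‖g₂ (p - r)‖ₑ ^ 2) ∂freqMeasure := by
  have hL := measurable_spatialLength
  have hw := measurable_bracketWeight
  have hker := lintegral_resonance_kernel_le hD hR σ (hw (2 * -b)) p
  set S : Set ℝ := {x : ℝ | D ≤ |x - σ * (p.2.1 - x)|} with hS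
  set T : Set ℤ := {n : ℤ | |(n : ℝ)| ≤ R} with hT
  have hSi : Measurable (S.indicator (1 : ℝ → ENNReal)) :=
    measurable_one.indicator (measurableSet_le measurable_const (by fun_prop))
  have hTi : Measurable (T.indicator (1 : ℤ → ENNReal)) := measurable_one.indicator .of_discrete
  have hcs := sq_lintegral_mul_le freqMeasure
    (f := fun r : Freq => S.indicator 1 r.2.1 * T.indicator 1 r.2.2 *
      (bracketWeight (-b) (r.1 - spatialLength r ^ 2) *
        bracketWeight (-b) ((p - r).1 - σ * spatialLength (p - r) ^ 2)))
    (g := fun r => bracketWeight b (r.1 - spatialLength r ^ 2) * ‖g₁ r‖ₑ *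
      (bracketWeight b ((p - r).1 - σ * spatialLength (p - r) ^ 2) * ‖g₂ (p - r)‖ₑ))
    (by fun_prop) (by fun_prop)
  refine (pow_le_pow_left₀ zero_le ((enorm_integral_le_lintegral_enorm _).trans
    (lintegral_mono_ae ?_)) 2).trans (hcs.trans (mul_le_mul' ?_ ?_))
  · filter_upwards [hs] with r hr
    by_cases h0 : g₁ r = 0
    · simp [h0]
    by_cases hx : r.2.1 ∈ S
    · have hn : r.2.2 ∈ T := (abs_snd_le_spatialLength r).trans (hr h0)
      have hx' : (r.2.1, (p - r).2.1) ∈ {x : ℝ × ℝ | D ≤ |x.1 - σ * x.2|} := hx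
      rw [Set.indicator_of_mem hx', Set.indicator_of_mem hx, Set.indicator_of_mem hn, one_mul,
        enorm_mul]
      have e1 := bracketWeight_neg_mul b (r.1 - spatialLength r ^ 2)
      have e2 := bracketWeight_neg_mul b ((p - r).1 - σ * spatialLength (p - r) ^ 2)
      refine le_of_eq ?_
      calc _ = (bracketWeight (-b) (r.1 - spatialLength r ^ 2) *
              bracketWeight b (r.1 - spatialLength r ^ 2)) * ‖g₁ r‖ₑ *
            ((bracketWeight (-b) ((p - r).1 - σ * spatialLength (p - r) ^ 2) *
              bracketWeight b ((p - r).1 - σ * spatialLength (p - r) ^ 2)) * ‖g₂ (p - r)‖ₑ) := by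
            rw [e1, e2]
            simp
        _ = _ := by
          simp only [Pi.one_apply]
          ring
    · have hx' : (r.2.1, (p - r).2.1) ∉ {x : ℝ × ℝ | D ≤ |x.1 - σ * x.2|} := hx
      rw [Set.indicator_of_notMem hx']
      simp
  · refine (lintegral_mono fun r => ?_).trans hker
    rw [mul_pow, mul_pow, mul_pow, bracketWeight_sq, bracketWeight_sq]
    by_cases hx : r.2.1 ∈ S <;> by_cases hn : r.2.2 ∈ T <;> simp [hx, hn]
  · refine lintegral_mono fun r => ?_
    rw [mul_pow, mul_pow, mul_pow, bracketWeight_sq, bracketWeight_sq, one_mul]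

theorem lintegral_lintegral_mul_sub {u v : Freq → ENNReal} (hu : Measurable u) (hv : Measurable v) :
    ∫⁻ p, ∫⁻ r, u r * v (p - r) ∂freqMeasure ∂freqMeasure
      = (∫⁻ r, u r ∂freqMeasure) * ∫⁻ p, v p ∂freqMeasure := by
  rw [lintegral_lintegral_swap (by fun_prop), ← lintegral_mul_const _ hu]
  refine lintegral_congr fun r => ?_
  rw [lintegral_const_mul _ (by fun_prop), lintegral_sub_right_eq_self]

theorem measurable_stChar_left (q : SpaceTime) : Measurable fun p => stChar p q := by
  have h : Measurable fun n : ℤ => (fourier (-n) q.2.2 : ℂ) := measurable_from_top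
  unfold stChar
  exact Measurable.mul (by fun_prop) (h.comp (by fun_prop : Measurable fun p : Freq => p.2.2))

theorem measurePreserving_shear_freqMeasure :
    MeasurePreserving (fun z : Freq × Freq => (z.1, z.2 - z.1))
      (freqMeasure.prod freqMeasure) (freqMeasure.prod freqMeasure) := by
  simpa only [neg_add_eq_sub] using measurePreserving_prod_neg_add freqMeasure freqMeasure

theorem integrable_integral_slice {P : Freq × Freq → ℂ}
    (hP : Integrable P (freqMeasure.prod freqMeasure)) :
    Integrable (fun p => ∫ r, P (r, p - r) ∂freqMeasure) freqMeasure :=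
  (measurePreserving_shear_freqMeasure.integrable_comp_of_integrable hP).integral_prod_right

theorem integrable_stChar_add_mul {P : Freq × Freq → ℂ}
    (hP : Integrable P (freqMeasure.prod freqMeasure)) (q : SpaceTime) :
    Integrable (fun z => stChar (z.1 + z.2) q * P z) (freqMeasure.prod freqMeasure) :=
  hP.bdd_mul (c := 1) ((measurable_stChar_left q).comp
    (measurable_fst.add measurable_snd)).aestronglyMeasurable
    (Eventually.of_forall fun _ => (norm_stChar _ _).le)

/-- The substitution `p = z₁ + z₂`: a product of Fourier integrals is the Fourier integral of a
convolution. -/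
theorem integral_stChar_add_mul {P : Freq × Freq → ℂ}
    (hP : Integrable P (freqMeasure.prod freqMeasure)) (q : SpaceTime) :
    ∫ z, stChar (z.1 + z.2) q * P z ∂(freqMeasure.prod freqMeasure)
      = ∫ p, stChar p q * ∫ r, P (r, p - r) ∂freqMeasure ∂freqMeasure := by
  have hs := measurePreserving_shear_freqMeasure
  have hH := hs.integrable_comp_of_integrable hP
  have h1 : Integrable (fun z : Freq × Freq => stChar z.2 q * P (z.1, z.2 - z.1))
      (freqMeasure.prod freqMeasure) :=
    hH.bdd_mul (c := 1) ((measurable_stChar_left q).comp measurable_snd).aestronglyMeasurable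
      (Eventually.of_forall fun _ => (norm_stChar _ _).le)
  have h2 := integral_map (f := fun z : Freq × Freq => stChar (z.1 + z.2) q * P z)
    hs.aemeasurable (by rw [hs.map_eq]; exact (integrable_stChar_add_mul hP q).1)
  rw [hs.map_eq] at h2
  simp only [add_sub_cancel] at h2
  rw [h2, integral_prod_symm _ h1]
  simp only [integral_const_mul]

/-- The bilinear estimate on the Fourier side for integrable, everywhere measurable `g₁`, `g₂`. The
case `σ = 1` concerns a product of two free waves, the case `σ = -1` a product of a free wave and a
conjugate one. -/
theorem bilinear_estimate_of_measurable {b D R σ : ℝ} (hD : 0 < D) (hR : 0 ≤ R)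
    {g₁ g₂ : Freq → ℂ} (hg₁ : Measurable g₁) (hg₂ : Measurable g₂)
    (hi₁ : Integrable g₁ freqMeasure) (hi₂ : Integrable g₂ freqMeasure)
    (hs : ∀ᵐ r ∂freqMeasure, g₁ r ≠ 0 → spatialLength r ≤ R) :
    (∀ q, Integrable (bilinearIntegrand {x : ℝ × ℝ | D ≤ |x.1 - σ * x.2|} g₁ g₂ q)
        (freqMeasure.prod freqMeasure)) ∧
      AEStronglyMeasurable (bilinearProduct {x : ℝ × ℝ | D ≤ |x.1 - σ * x.2|} g₁ g₂) volume ∧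
      ∫⁻ q, ‖bilinearProduct {x : ℝ × ℝ | D ≤ |x.1 - σ * x.2|} g₁ g₂ q‖ₑ ^ 2
        ≤ ENNReal.ofReal ((2 * Real.pi) ^ 3) * (ENNReal.ofReal (2 * R + 1) *
            ((ENNReal.ofReal D)⁻¹ * (∫⁻ v, bracketWeight (2 * -b) v) ^ 2)) *
          (twistedNormSq 1 b g₁ * twistedNormSq σ b g₂) := by
  have hSm : MeasurableSet {x : ℝ × ℝ | D ≤ |x.1 - σ * x.2|} :=
    measurableSet_le measurable_const (by fun_prop)
  have hslice := enorm_integral_slice_sq_le (b := b) hD hR σ hg₁ hg₂ hs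
  -- only measurability of the cut-off set matters from here on
  generalize {x : ℝ × ℝ | D ≤ |x.1 - σ * x.2|} = S at hSm hslice ⊢
  have hSi : Measurable (S.indicator fun _ => (1 : ℂ)) := measurable_const.indicator hSm
  have hSn : ∀ x, ‖S.indicator (fun _ => (1 : ℂ)) x‖ ≤ 1 := fun x => by
    by_cases hx : x ∈ S <;> simp [hx]
  have hP : Integrable (fun z : Freq × Freq =>
      S.indicator (fun _ => (1 : ℂ)) (z.1.2.1, z.2.2.1) * g₁ z.1 * g₂ z.2)
      (freqMeasure.prod freqMeasure) := by
    simp_rw [mul_assoc]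
    exact (hi₁.mul_prod hi₂).bdd_mul (c := 1)
      (Measurable.aestronglyMeasurable (by fun_prop)) (Eventually.of_forall fun _ => hSn _)
  have hBI : ∀ q, bilinearIntegrand S g₁ g₂ q = fun z => stChar (z.1 + z.2) q *
      (S.indicator (fun _ => (1 : ℂ)) (z.1.2.1, z.2.2.1) * g₁ z.1 * g₂ z.2) := fun q => by
    ext z
    simp only [bilinearIntegrand, mul_assoc]
  have hG := integrable_integral_slice hP
  have hF : bilinearProduct S g₁ g₂ = fun q => ∫ p, stChar p q *
      (∫ r, S.indicator (fun _ => (1 : ℂ)) (r.2.1, (p - r).2.1) * g₁ r * g₂ (p - r)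
        ∂freqMeasure) ∂freqMeasure := by
    ext q
    rw [bilinearProduct, hBI]
    exact integral_stChar_add_mul hP q
  refine ⟨fun q => ?_, ?_, ?_⟩
  · rw [hBI]
    exact integrable_stChar_add_mul hP q
  · rw [hF]
    refine AEStronglyMeasurable.integral_prod_right' (f := fun z : SpaceTime × Freq =>
      stChar z.2 z.1 * ∫ r, S.indicator (fun _ => (1 : ℂ)) (r.2.1, (z.2 - r).2.1) * g₁ r *
        g₂ (z.2 - r) ∂freqMeasure) ?_
    exact (measurable_stChar.comp measurable_swap).aestronglyMeasurable.mul hG.1.comp_snd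
  · have hL := measurable_spatialLength
    have hw := measurable_bracketWeight
    rw [hF]
    refine (besselBound_stChar _ hG).trans ?_
    rw [mul_assoc]
    refine mul_le_mul_right ((lintegral_mono hslice).trans_eq ?_) _
    rw [lintegral_const_mul _ (by fun_prop)]
    congr 1
    exact lintegral_lintegral_mul_sub
      (u := fun r => bracketWeight (2 * b) (r.1 - 1 * spatialLength r ^ 2) * ‖g₁ r‖ₑ ^ 2)
      (v := fun r => bracketWeight (2 * b) (r.1 - σ * spatialLength r ^ 2) * ‖g₂ r‖ₑ ^ 2)
      (by fun_prop) (by fun_prop)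

/-! ### The transform of the complex conjugate -/

theorem stChar_neg (p : Freq) (q : SpaceTime) :
    stChar (-p) q = starRingEnd ℂ (stChar p q) := by
  simp only [stChar, map_mul, ← Complex.exp_conj, Prod.fst_neg, Prod.snd_neg]
  rw [fourier_neg (n := -p.2.2)]
  congr 2
  simp
  ring

theorem stFourierTrunc_conj (f : SpaceTime → ℂ) (R : ℝ) (p : Freq) :
    stFourierTrunc (fun r => starRingEnd ℂ (f r)) R p
      = starRingEnd ℂ (stFourierTrunc f R (-p)) := by
  simp only [stFourierTrunc, map_mul, Complex.conj_ofReal, ← integral_conj, stChar_neg,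
    Complex.conj_conj]

theorem eLpNorm_conj_comp_neg {g : Freq → ℂ} (hg : AEStronglyMeasurable g freqMeasure) :
    eLpNorm (fun p => starRingEnd ℂ (g (-p))) 2 freqMeasure = eLpNorm g 2 freqMeasure := by
  rw [← eLpNorm_comp_measurePreserving hg measurePreserving_neg_freqMeasure]
  exact eLpNorm_congr_norm_ae (Eventually.of_forall fun p => by simp)

theorem aestronglyMeasurable_stFourierTrunc {f : SpaceTime → ℂ}
    (hf : AEStronglyMeasurable f volume) (R : ℝ) :
    AEStronglyMeasurable (stFourierTrunc f R) freqMeasure := by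
  refine AEStronglyMeasurable.const_mul ?_ _
  refine AEStronglyMeasurable.integral_prod_right' (f := fun z : Freq × SpaceTime =>
    stChar z.1 z.2 * f z.2) ?_
  exact measurable_stChar.aestronglyMeasurable.mul (hf.restrict.comp_snd)

theorem IsSTFourier.conj {f : SpaceTime → ℂ} {g : Freq → ℂ}
    (hf : AEStronglyMeasurable f volume) (h : IsSTFourier f g) :
    IsSTFourier (fun r => starRingEnd ℂ (f r)) (fun p => starRingEnd ℂ (g (-p))) := by
  refine ⟨⟨?_, ?_⟩, ?_⟩
  · exact Complex.continuous_conj.comp_aestronglyMeasurable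
      (h.1.1.comp_measurePreserving measurePreserving_neg_freqMeasure)
  · rw [eLpNorm_conj_comp_neg h.1.1]
    exact h.1.2
  · refine h.2.congr fun R => ?_
    rw [← eLpNorm_conj_comp_neg ((aestronglyMeasurable_stFourierTrunc hf R).sub h.1.1)]
    congr 1
    ext p
    simp [stFourierTrunc_conj]

/-- Limits in `L²` are unique almost everywhere. -/
theorem IsSTFourier.ae_eq {f : SpaceTime → ℂ} {g g' : Freq → ℂ}
    (hf : AEStronglyMeasurable f volume) (h : IsSTFourier f g) (h' : IsSTFourier f g') :
    g =ᵐ[freqMeasure] g' := by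
  have hm := aestronglyMeasurable_stFourierTrunc hf
  have hle : ∀ R : ℝ, eLpNorm (g - g') 2 freqMeasure ≤
      eLpNorm (stFourierTrunc f R - g') 2 freqMeasure
        + eLpNorm (stFourierTrunc f R - g) 2 freqMeasure := fun R => by
    have := eLpNorm_sub_le ((hm R).sub h'.1.1) ((hm R).sub h.1.1) (p := 2) (by norm_num)
    rwa [sub_sub_sub_cancel_left] at this
  have h0 : eLpNorm (g - g') 2 freqMeasure = 0 := by
    refine le_antisymm ?_ zero_le
    have := h'.2.add h.2
    rw [add_zero] at this
    exact ge_of_tendsto' this hle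
  have := (eLpNorm_eq_zero_iff (h.1.1.sub h'.1.1) (by norm_num)).1 h0
  filter_upwards [this] with p hp
  exact sub_eq_zero.1 hp

theorem memLp_stFourier (f : SpaceTime → ℂ) : MemLp (stFourier f) 2 freqMeasure := by
  unfold stFourier
  split_ifs with h
  · exact h.choose_spec.1
  · exact MemLp.zero'

/-- The transform of `conj f` is `conj (f̂(-τ,-ζ))`. If `f` had no transform, then neither would
`conj f`, and both sides would be the default value `0`. -/
theorem stFourier_conj {f : SpaceTime → ℂ} (hf : AEStronglyMeasurable f volume) :
    stFourier (fun r => starRingEnd ℂ (f r)) =ᵐ[freqMeasure]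
      fun p => starRingEnd ℂ (stFourier f (-p)) := by
  have hf' : AEStronglyMeasurable (fun r => starRingEnd ℂ (f r)) volume :=
    Complex.continuous_conj.comp_aestronglyMeasurable hf
  by_cases h : ∃ g, IsSTFourier f g
  · have h1 : IsSTFourier f (stFourier f) := by
      rw [stFourier, dif_pos h]
      exact h.choose_spec
    have h2 : ∃ g, IsSTFourier (fun r => starRingEnd ℂ (f r)) g := ⟨_, h1.conj hf⟩
    have h3 : IsSTFourier (fun r => starRingEnd ℂ (f r))
        (stFourier fun r => starRingEnd ℂ (f r)) := by
      rw [stFourier, dif_pos h2]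
      exact h2.choose_spec
    exact h3.ae_eq hf' (h1.conj hf)
  · have h2 : ¬ ∃ g, IsSTFourier (fun r => starRingEnd ℂ (f r)) g := by
      rintro ⟨g, hg⟩
      have := hg.conj hf'
      simp only [Complex.conj_conj] at this
      exact h ⟨_, this⟩
    rw [stFourier, dif_neg h2, stFourier, dif_neg h]
    exact Eventually.of_forall fun p => by simp

/-! ### The bilinear estimate in `X^{0,b}` -/

theorem twistedNormSq_congr {σ b : ℝ} {g g' : Freq → ℂ} (h : g =ᵐ[freqMeasure] g') :
    twistedNormSq σ b g = twistedNormSq σ b g' :=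
  lintegral_congr_ae (by filter_upwards [h] with p hp; rw [hp])

/-- The bilinear estimate on the Fourier side, for functions measurable up to null sets. -/
theorem bilinear_estimate {b D R₁ R₂ σ : ℝ} (hb : 1 / 2 < b) (hD : 0 < D) (hR₁ : 0 ≤ R₁)
    (hR₂ : 0 ≤ R₂) {g₁ g₂ : Freq → ℂ} (hg₁ : AEStronglyMeasurable g₁ freqMeasure)
    (hg₂ : AEStronglyMeasurable g₂ freqMeasure)
    (hs₁ : ∀ᵐ p ∂freqMeasure, g₁ p ≠ 0 → spatialLength p ≤ R₁)
    (hs₂ : ∀ᵐ p ∂freqMeasure, g₂ p ≠ 0 → spatialLength p ≤ R₂)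
    (hX₁ : twistedNormSq 1 b g₁ < ⊤) (hX₂ : twistedNormSq σ b g₂ < ⊤) :
    (∀ q, Integrable (bilinearIntegrand {x : ℝ × ℝ | D ≤ |x.1 - σ * x.2|} g₁ g₂ q)
        (freqMeasure.prod freqMeasure)) ∧
      MemLp (bilinearProduct {x : ℝ × ℝ | D ≤ |x.1 - σ * x.2|} g₁ g₂) 2 volume ∧
      eLpNorm (bilinearProduct {x : ℝ × ℝ | D ≤ |x.1 - σ * x.2|} g₁ g₂) 2 volume
        ≤ (ENNReal.ofReal ((2 * Real.pi) ^ 3) * (ENNReal.ofReal (2 * R₁ + 1) *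
            ((ENNReal.ofReal D)⁻¹ * (∫⁻ v, bracketWeight (2 * -b) v) ^ 2))) ^ (1 / 2 : ℝ) *
          twistedNormSq 1 b g₁ ^ (1 / 2 : ℝ) * twistedNormSq σ b g₂ ^ (1 / 2 : ℝ) := by
  have e₁ := hg₁.ae_eq_mk
  have e₂ := hg₂.ae_eq_mk
  have m₁ := hg₁.stronglyMeasurable_mk.measurable
  have m₂ := hg₂.stronglyMeasurable_mk.measurable
  have hs₁' : ∀ᵐ p ∂freqMeasure, hg₁.mk g₁ p ≠ 0 → spatialLength p ≤ R₁ := by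
    filter_upwards [hs₁, e₁] with p hp he
    rwa [← he]
  have hs₂' : ∀ᵐ p ∂freqMeasure, hg₂.mk g₂ p ≠ 0 → spatialLength p ≤ R₂ := by
    filter_upwards [hs₂, e₂] with p hp he
    rwa [← he]
  have hX₁' := hX₁
  have hX₂' := hX₂
  rw [twistedNormSq_congr e₁] at hX₁'
  rw [twistedNormSq_congr e₂] at hX₂'
  obtain ⟨h1, h2, h3⟩ := bilinear_estimate_of_measurable (b := b) (σ := σ) hD hR₁ m₁ m₂
    (integrable_of_twistedNormSq_lt_top hb hR₁ m₁ hs₁' hX₁')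
    (integrable_of_twistedNormSq_lt_top hb hR₂ m₂ hs₂' hX₂') hs₁'
  have hae : ∀ q, bilinearIntegrand {x : ℝ × ℝ | D ≤ |x.1 - σ * x.2|} (hg₁.mk g₁) (hg₂.mk g₂) q
      =ᵐ[freqMeasure.prod freqMeasure]
        bilinearIntegrand {x : ℝ × ℝ | D ≤ |x.1 - σ * x.2|} g₁ g₂ q := fun q => by
    filter_upwards [Measure.quasiMeasurePreserving_fst.ae_eq_comp e₁,
      Measure.quasiMeasurePreserving_snd.ae_eq_comp e₂] with z hz₁ hz₂
    simp only [Function.comp] at hz₁ hz₂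
    simp only [bilinearIntegrand, hz₁, hz₂]
  have hprod : bilinearProduct {x : ℝ × ℝ | D ≤ |x.1 - σ * x.2|} (hg₁.mk g₁) (hg₂.mk g₂)
      = bilinearProduct {x : ℝ × ℝ | D ≤ |x.1 - σ * x.2|} g₁ g₂ :=
    funext fun q => integral_congr_ae (hae q)
  rw [hprod] at h2 h3
  rw [← twistedNormSq_congr e₁, ← twistedNormSq_congr e₂] at h3
  have hle : eLpNorm (bilinearProduct {x : ℝ × ℝ | D ≤ |x.1 - σ * x.2|} g₁ g₂) 2 volume
        ≤ (ENNReal.ofReal ((2 * Real.pi) ^ 3) * (ENNReal.ofReal (2 * R₁ + 1) *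
            ((ENNReal.ofReal D)⁻¹ * (∫⁻ v, bracketWeight (2 * -b) v) ^ 2))) ^ (1 / 2 : ℝ) *
          twistedNormSq 1 b g₁ ^ (1 / 2 : ℝ) * twistedNormSq σ b g₂ ^ (1 / 2 : ℝ) := by
    have half : (0 : ℝ) ≤ 1 / 2 := by norm_num
    rw [← ENNReal.mul_rpow_of_nonneg _ _ half, ← ENNReal.mul_rpow_of_nonneg _ _ half,
      mul_assoc _ (twistedNormSq 1 b g₁)]
    rw [← eLpNorm_two_sq] at h3
    have := ENNReal.rpow_le_rpow h3 half
    rwa [← ENNReal.rpow_natCast, ← ENNReal.rpow_mul, Nat.cast_ofNat,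
      mul_one_div_cancel two_ne_zero, ENNReal.rpow_one] at this
  have half : (0 : ℝ) ≤ 1 / 2 := by norm_num
  refine ⟨fun q => (h1 q).congr (hae q), ⟨h2, hle.trans_lt ?_⟩, hle⟩
  refine ENNReal.mul_lt_top (ENNReal.mul_lt_top (ENNReal.rpow_lt_top_of_nonneg half ?_)
    (ENNReal.rpow_lt_top_of_nonneg half hX₁.ne)) (ENNReal.rpow_lt_top_of_nonneg half hX₂.ne)
  exact ENNReal.mul_ne_top ENNReal.ofReal_ne_top (ENNReal.mul_ne_top ENNReal.ofReal_ne_top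
    (ENNReal.mul_ne_top (ENNReal.inv_ne_top.2 (by simpa using hD))
      (ENNReal.pow_ne_top (lintegral_bracketWeight_lt_top hb).ne)))

theorem xNorm_zero_eq (b : ℝ) (f : SpaceTime → ℂ) :
    xNorm 0 b f = twistedNormSq 1 b (stFourier f) ^ (1 / 2 : ℝ) := by
  simp [xNorm, twistedNormSq, bracketWeight]

theorem twistedNormSq_stFourier_conj {f : SpaceTime → ℂ} (hf : AEStronglyMeasurable f volume)
    (b : ℝ) :
    twistedNormSq (-1) b (stFourier fun r => starRingEnd ℂ (f r))
      = twistedNormSq 1 b (stFourier f) := by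
  have hneg : ∀ v : Freq → ENNReal, ∫⁻ p, v (-p) ∂freqMeasure = ∫⁻ p, v p ∂freqMeasure :=
    measurePreserving_neg_freqMeasure.lintegral_comp_emb
      (MeasurableEquiv.neg Freq).measurableEmbedding
  rw [twistedNormSq_congr (stFourier_conj hf), twistedNormSq, twistedNormSq, ← hneg]
  refine lintegral_congr fun p => ?_
  have hL : spatialLength (-p) = spatialLength p := by simp [spatialLength]
  have hJ : ∀ r, bracketWeight (2 * b) (-r) = bracketWeight (2 * b) r := fun r => by
    simp [bracketWeight, japaneseBracket]
  rw [hL, ← hJ]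
  simp
  ring_nf

theorem HasSpatialFreq.conj {K N : ℝ} {f : SpaceTime → ℂ} (hf : AEStronglyMeasurable f volume)
    (h : HasSpatialFreq K N f) : HasSpatialFreq K N fun r => starRingEnd ℂ (f r) := by
  have := measurePreserving_neg_freqMeasure.quasiMeasurePreserving.ae h
  filter_upwards [this, stFourier_conj hf] with p hp he h0
  have hL : spatialLength (-p) = spatialLength p := by simp [spatialLength]
  rw [hL] at hp
  refine hp fun h1 => h0 ?_
  rw [he, h1, map_zero]

/-- The constant with `R = K N` and `D = c M`; the number `2 K N + 1` of admissible `η₁` is at most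
`3 K N` because `K N ≥ 1`. -/
theorem rpow_half_constant_le {K c N M j : ℝ} (hK : 1 ≤ K) (hc : 0 < c) (hN : 1 < N) (hM : 1 < M)
    {J : ENNReal} (hJ : J = ENNReal.ofReal j) (hj : 0 ≤ j) :
    (ENNReal.ofReal ((2 * Real.pi) ^ 3) * (ENNReal.ofReal (2 * (K * N) + 1) *
        ((ENNReal.ofReal (c * M))⁻¹ * J ^ 2))) ^ (1 / 2 : ℝ)
      ≤ ENNReal.ofReal ((Real.sqrt ((2 * Real.pi) ^ 3 * (3 * K * j ^ 2 / c)) + 1) *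
          (N ^ (1 / 2 : ℝ) / M ^ (1 / 2 : ℝ))) := by
  have hπ := Real.two_pi_pos
  have hN0 : 0 < N := by linarith
  have hM0 : 0 < M := by linarith
  have hKN : 1 ≤ K * N := one_le_mul_of_one_le_of_one_le hK hN.le
  rw [hJ, ← ENNReal.ofReal_inv_of_pos (by positivity), ← ENNReal.ofReal_pow hj,
    ← ENNReal.ofReal_mul (by positivity), ← ENNReal.ofReal_mul (by positivity),
    ← ENNReal.ofReal_mul (by positivity),
    ENNReal.ofReal_rpow_of_nonneg (by positivity) (by norm_num),
    ← Real.sqrt_eq_rpow, ← Real.sqrt_eq_rpow, ← Real.sqrt_eq_rpow]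
  refine ENNReal.ofReal_le_ofReal ?_
  calc √((2 * Real.pi) ^ 3 * ((2 * (K * N) + 1) * ((c * M)⁻¹ * j ^ 2)))
      ≤ √((2 * Real.pi) ^ 3 * ((3 * (K * N)) * ((c * M)⁻¹ * j ^ 2))) := by
        gcongr
        linarith
    _ = √((2 * Real.pi) ^ 3 * (3 * K * j ^ 2 / c)) * (√N / √M) := by
        rw [← Real.sqrt_div hN0.le, ← Real.sqrt_mul (by positivity)]
        congr 1
        field_simp
    _ ≤ _ := by
        gcongr
        linarith

theorem proposition3p1 :
    ∀ ε : ℝ, 0 < ε → ∀ K : ℝ, 1 ≤ K → ∀ c : ℝ, 0 < c →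
      ∃ C : ℝ, 0 < C ∧
        ∀ N₁ N₂ M : ℝ, 1 < N₁ → N₁ ≤ N₂ → 1 < M →
          ∀ f₁ f₂ : SpaceTime → ℂ,
            MemX 0 (1 / 2 + ε) f₁ → MemX 0 (1 / 2 + ε) f₂ →
            HasSpatialFreq K N₁ f₁ → HasSpatialFreq K N₂ f₂ →
            -- the product of `f₁` and `f₂` restricted to `|ξ₁ - ξ₂| ≥ c M`
            ((∀ q : SpaceTime, Integrable
                (bilinearIntegrand {x : ℝ × ℝ | c * M ≤ |x.1 - x.2|}
                  (stFourier f₁) (stFourier f₂) q) (freqMeasure.prod freqMeasure)) ∧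
              MemLp (bilinearProduct {x : ℝ × ℝ | c * M ≤ |x.1 - x.2|}
                  (stFourier f₁) (stFourier f₂)) 2 volume ∧
              eLpNorm (bilinearProduct {x : ℝ × ℝ | c * M ≤ |x.1 - x.2|}
                  (stFourier f₁) (stFourier f₂)) 2 volume ≤
                ENNReal.ofReal (C * (N₁ ^ (1 / 2 : ℝ) / M ^ (1 / 2 : ℝ))) *
                  xNorm 0 (1 / 2 + ε) f₁ * xNorm 0 (1 / 2 + ε) f₂) ∧
            -- the product of `f₁` and the conjugate of `f₂` restricted to `|ξ₁ + ξ₂| ≥ c M`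
            ((∀ q : SpaceTime, Integrable
                (bilinearIntegrand {x : ℝ × ℝ | c * M ≤ |x.1 + x.2|}
                  (stFourier f₁) (stFourier (fun r => starRingEnd ℂ (f₂ r))) q)
                (freqMeasure.prod freqMeasure)) ∧
              MemLp (bilinearProduct {x : ℝ × ℝ | c * M ≤ |x.1 + x.2|}
                  (stFourier f₁) (stFourier (fun r => starRingEnd ℂ (f₂ r)))) 2 volume ∧
              eLpNorm (bilinearProduct {x : ℝ × ℝ | c * M ≤ |x.1 + x.2|}
                  (stFourier f₁) (stFourier (fun r => starRingEnd ℂ (f₂ r)))) 2 volume ≤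
                ENNReal.ofReal (C * (N₁ ^ (1 / 2 : ℝ) / M ^ (1 / 2 : ℝ))) *
                  xNorm 0 (1 / 2 + ε) f₁ * xNorm 0 (1 / 2 + ε) f₂) := by
  intro ε hε K hK c hc
  set b : ℝ := 1 / 2 + ε with hbdef
  have hb : 1 / 2 < b := by linarith
  set J : ENNReal := ∫⁻ v, bracketWeight (2 * -b) v with hJ
  have hJr : J = ENNReal.ofReal J.toReal :=
    (ENNReal.ofReal_toReal (lintegral_bracketWeight_lt_top hb).ne).symm
  refine ⟨Real.sqrt ((2 * Real.pi) ^ 3 * (3 * K * J.toReal ^ 2 / c)) + 1, by positivity, ?_⟩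
  intro N₁ N₂ M hN₁ hN₂ hM f₁ f₂ hf₁ hf₂ hF₁ hF₂
  have hconst := rpow_half_constant_le hK hc hN₁ hM hJr ENNReal.toReal_nonneg
  have hcM : 0 < c * M := mul_pos hc (by linarith)
  have hR₁ : 0 ≤ K * N₁ := mul_nonneg (by linarith) (by linarith)
  have hR₂ : 0 ≤ K * N₂ := mul_nonneg (by linarith) (by linarith)
  have fin : ∀ f, MemX 0 b f → twistedNormSq 1 b (stFourier f) < ⊤ := fun f hf => by
    have := hf.2
    rw [xNorm_zero_eq] at this
    exact (ENNReal.rpow_lt_top_iff_of_pos (by norm_num)).1 this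
  have supp : ∀ {N f}, HasSpatialFreq K N f →
      ∀ᵐ p ∂freqMeasure, stFourier f p ≠ 0 → spatialLength p ≤ K * N := fun h => by
    filter_upwards [h] with p hp h0 using (hp h0).2
  simp only [xNorm_zero_eq]
  constructor
  · have h := bilinear_estimate (σ := 1) hb hcM hR₁ hR₂ (memLp_stFourier f₁).1
      (memLp_stFourier f₂).1 (supp hF₁) (supp hF₂) (fin f₁ hf₁) (fin f₂ hf₂)
    simp only [one_mul] at h
    refine ⟨h.1, h.2.1, h.2.2.trans ?_⟩
    gcongr
  · have hc₂ := twistedNormSq_stFourier_conj hf₂.1.1 b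
    have h := bilinear_estimate (σ := -1) hb hcM hR₁ hR₂ (memLp_stFourier f₁).1
      (memLp_stFourier fun r => starRingEnd ℂ (f₂ r)).1 (supp hF₁) (supp (hF₂.conj hf₂.1.1))
      (fin f₁ hf₁) (hc₂.trans_lt (fin f₂ hf₂))
    simp only [neg_mul, one_mul, sub_neg_eq_add, hc₂] at h
    refine ⟨h.1, h.2.1, h.2.2.trans ?_⟩
    gcongr
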